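/- Let $f:\,]-1,+\infty[\,\to\mathbb R$ be of class $C^2$ with $f(0)=0$, $f'(0)=-1$, $f'(y)<0<f''(y)$ for all $y>-1$, and $\lim_{y\to-1^+}f(y)=+\infty$. Let $\omega>0$, $T=2\pi/\omega$ and $\theta=\arctan\omega$. For every $A\ge 0$ let $Y(\cdot,A):\mathbb R\to\,]-1,+\infty[$ denote the $T$-periodic solution, which exists and is unique, of $$\frac{dy}{dt}=f(y)+A\sin\omega t .$$ Then the following holds. 1. For every $A>0$, $Y(\cdot,A)$ has exactly two roots $t_{Y_1}<t_{Y_2}$ in $[0,T]$; its maximum over $[0,T]$ is positive and is attained at a single point $t_{Y_{\max}}$; its minimum over $[0,T]$ is negative and is attained at a single point $t_{Y_{\min}}$. Moreover $$0<t_{Y_1}<\tfrac T2<t_{Y_2}<T,\qquad t_{Y_1}<t_{Y_{\max}}<t_{Y_2}<t_{Y_{\min}},\qquad \tfrac T4<t_{Y_{\max}}<\tfrac T2,\qquad \tfrac{3T}4<t_{Y_{\min}}<T .$$ 2. As $A\to0^+$, uniformly in $t$, $$Y(t,A)=\frac{A}{\sqrt{1+\omega^2}}\,\sin(\omega t-\theta)+\mathcal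 O(A^2),$$ that is, there are $C$ and $\delta>0$, depending only on $f$ and $\omega$, such that $\left|Y(t,A)-\frac{A}{\sqrt{1+\omega^2}}\sin(\omega t-\theta)\right|\le C A^2$ for all $t\in\mathbb R$ and $0\le A\le\delta$. 3. As $A\to0^+$, $$t_{Y_1}\to\frac\theta\omega,\qquad t_{Y_{\max}}\to\frac\theta\omega+\frac T4,\qquad t_{Y_2}\to\frac\theta\omega+\frac T2,\qquad t_{Y_{\min}}\to\frac\theta\omega+\frac{3T}4 .$$ -/

import Mathlib

open Set Filter Topology

/-- The admissible nonlinearities `f = -𝓕`, where `𝓕` is the dimensionless stress-closure relation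
of the crack. Only the values of `f` on `]-1, +∞[` matter. The codomain `]f_min, +∞[`,
`-∞ ≤ f_min < 0`, is not a further restriction: `f` is continuous and strictly decreasing on
`]-1, +∞[`, with `f 0 = 0` and limit `+∞` at `-1`, so its range is such an interval. -/
structure IsCrackLaw (f : ℝ → ℝ) : Prop where
  contDiffOn : ContDiffOn ℝ 2 f (Ioi (-1))
  tendsto_atTop : Tendsto f (𝓝[>] (-1)) atTop
  map_zero : f 0 = 0
  deriv_zero : deriv f 0 = -1
  deriv_neg : ∀ y, -1 < y → deriv f y < 0
  deriv_deriv_pos : ∀ y, -1 < y → 0 < deriv (deriv f) y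

/-- The forcing period `T = 2π/ω`. -/
noncomputable def forcingPeriod (ω : ℝ) : ℝ := 2 * Real.pi / ω

/-- `y` is a `T`-periodic solution, with values in `]-1, +∞[`, of `y' = f(y) + A sin(ω t)`,
where `T = 2π/ω`. -/
structure IsPeriodicSolution (f : ℝ → ℝ) (ω A : ℝ) (y : ℝ → ℝ) : Prop where
  neg_one_lt : ∀ t, -1 < y t
  hasDerivAt : ∀ t, HasDerivAt y (f (y t) + A * Real.sin (ω * t)) t
  periodic : Function.Periodic y (forcingPeriod ω)

/-- `t₁`, `t₂`, `tmax`, `tmin` are the critical times of `y` on `[0, T]`: the roots `t₁`, `t₂`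
(exactly two), the unique maximum point `tmax`, with positive maximum, and the unique minimum
point `tmin`, with negative minimum; and these times are ordered and located as stated. -/
structure AreCriticalTimes (T : ℝ) (y : ℝ → ℝ) (t₁ t₂ tmax tmin : ℝ) : Prop where
  roots : {t | t ∈ Icc 0 T ∧ y t = 0} = {t₁, t₂}
  max_pos : 0 < y tmax
  lt_max : ∀ t ∈ Icc 0 T, t ≠ tmax → y t < y tmax
  min_neg : y tmin < 0
  min_lt : ∀ t ∈ Icc 0 T, t ≠ tmin → y tmin < y t
  roots_order : 0 < t₁ ∧ t₁ < T / 2 ∧ T / 2 < t₂ ∧ t₂ < T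
  critical_order : t₁ < tmax ∧ tmax < t₂ ∧ t₂ < tmin
  max_mem : tmax ∈ Ioo (T / 4) (T / 2)
  min_mem : tmin ∈ Ioo (3 * T / 4) T

/-! Everything rests on two principles for scalar periodic functions. First, a periodic function is
bounded by its values at its critical points. Applied to `y + (A/ω) cos ωt`, whose derivative is
`f(y)`, it gives `|y| ≤ 2A/ω`. Applied to a difference of two solutions, it gives uniqueness.
Applied to the difference `y - η` with the linear response, it gives part 2: where `y' = η'`, the
error `y - η` equals the Taylor remainder `f(y) + y = O(y²) = O(A²)`. Second, a solution of `w' = c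
w + h` that is nonnegative somewhere becomes and stays positive while `h > 0`, and symmetrically. So
a periodic `w` taking both signs changes sign once in each half-period of `h`
(`exists_sign_changes_of_periodic_linear_ode`). Both `y` and `y'` solve such equations, with sources
`A sin ωt` and `Aω cos ωt`; this yields the two roots and the two extrema, and the sign of `f(y)` at
the extrema sharpens their location. Existence is a contraction argument for `f` modified outside a
compact interval, which the a priori bounds show is never left. In part 3 the `O(A²)` bounds on `y`
and `y'`, divided by `A`, force the sine or cosine of the phase to `0`, and the location of each
time selects the zero. -/

/-- A continuous periodic function on the line attains its maximum. -/
lemma Function.Periodic.exists_forall_le {u : ℝ → ℝ} {T : ℝ} (hu : Function.Periodic u T)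
    (hT : 0 < T) (hc : Continuous u) : ∃ t, ∀ s, u s ≤ u t := by
  obtain ⟨t, -, ht⟩ := isCompact_Icc.exists_isMaxOn (nonempty_Icc.2 hT.le) hc.continuousOn
  refine ⟨t, fun s => ?_⟩
  obtain ⟨r, hr, hsr⟩ := hu.exists_mem_Ico₀ hT s
  rw [hsr]
  exact ht (Ico_subset_Icc_self hr)

/-- If a periodic differentiable function is nonpositive at each of its critical points, it is
nonpositive everywhere. -/
lemma Function.Periodic.le_of_forall_deriv_eq_zero {u u' : ℝ → ℝ} {T B : ℝ}
    (hu : Function.Periodic u T) (hT : 0 < T) (hd : ∀ t, HasDerivAt u (u' t) t)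
    (h : ∀ t, u' t = 0 → u t ≤ B) (t : ℝ) : u t ≤ B := by
  obtain ⟨s, hs⟩ := hu.exists_forall_le hT
    (continuous_iff_continuousAt.2 fun t => (hd t).continuousAt)
  refine (hs t).trans (h s ?_)
  exact IsLocalMax.hasDerivAt_eq_zero (Eventually.of_forall hs) (hd s)

lemma Function.Periodic.ge_of_forall_deriv_eq_zero {u u' : ℝ → ℝ} {T B : ℝ}
    (hu : Function.Periodic u T) (hT : 0 < T) (hd : ∀ t, HasDerivAt u (u' t) t)
    (h : ∀ t, u' t = 0 → B ≤ u t) (t : ℝ) : B ≤ u t := by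
  have hp : Function.Periodic (fun t => -u t) T := fun t => by simp only [hu t]
  have := hp.le_of_forall_deriv_eq_zero (B := -B) hT (fun t => (hd t).neg)
    (fun t ht => neg_le_neg (h t (by simpa using ht))) t
  linarith

/-- A periodic function whose derivative is nonnegative has zero derivative. -/
lemma Function.Periodic.deriv_eq_zero_of_nonneg {u u' : ℝ → ℝ} {T : ℝ}
    (hu : Function.Periodic u T) (hT : 0 < T) (hd : ∀ t, HasDerivAt u (u' t) t)
    (h : ∀ t, 0 ≤ u' t) (t : ℝ) : u' t = 0 := by
  have hm : Monotone u := monotone_of_hasDerivAt_nonneg hd h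
  have hconst : ∀ s t, u s ≤ u t := fun s t => by
    obtain ⟨r, hr, hsr⟩ := hu.exists_mem_Ioc hT s (t - T)
    rw [hsr]
    exact hm (by simpa using hr.2)
  have : u = fun _ => u 0 := funext fun s => le_antisymm (hconst _ _) (hconst _ _)
  have h0 : HasDerivAt u 0 t := by rw [this]; exact hasDerivAt_const _ _
  exact (hd t).unique h0

/-! ### Sign changes for scalar linear equations -/

/-- A solution of the linear equation `w' = c w + h` with positive source and nonnegative initial
value is positive. -/
lemma pos_of_linear_ode {w c h : ℝ → ℝ} {a b : ℝ} (hc : Continuous c)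
    (hw : ∀ t, HasDerivAt w (c t * w t + h t) t) (hh : ∀ t ∈ Ioo a b, 0 < h t)
    (ha : 0 ≤ w a) {t : ℝ} (ht : t ∈ Ioc a b) : 0 < w t := by
  set C : ℝ → ℝ := fun t => ∫ s in a..t, c s with hC
  have hCd : ∀ t, HasDerivAt C (c t) t := fun t =>
    intervalIntegral.integral_hasDerivAt_right (hc.intervalIntegrable _ _)
      (hc.stronglyMeasurableAtFilter _ _) hc.continuousAt
  -- The integrating factor removes the term `c w`, leaving a derivative with the sign of `h`.
  have hv : ∀ t, HasDerivAt (fun t => w t * Real.exp (-C t)) (h t * Real.exp (-C t)) t := fun t =>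
    ((hw t).mul (hCd t).fun_neg.exp).congr_deriv (by ring)
  have hmono : StrictMonoOn (fun t => w t * Real.exp (-C t)) (Icc a b) := by
    refine strictMonoOn_of_deriv_pos (convex_Icc a b)
      (fun t _ => (hv t).continuousAt.continuousWithinAt) fun t ht => ?_
    rw [interior_Icc] at ht
    rw [(hv t).deriv]
    exact mul_pos (hh t ht) (Real.exp_pos _)
  have h1 := hmono ⟨le_rfl, ht.1.le.trans ht.2⟩ ⟨ht.1.le, ht.2⟩ ht.1
  have h2 : 0 ≤ w a * Real.exp (-C a) := mul_nonneg ha (Real.exp_pos _).le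
  exact pos_of_mul_pos_left (h2.trans_lt h1) (Real.exp_pos _).le

lemma neg_of_linear_ode {w c h : ℝ → ℝ} {a b : ℝ} (hc : Continuous c)
    (hw : ∀ t, HasDerivAt w (c t * w t + h t) t) (hh : ∀ t ∈ Ioo a b, h t < 0)
    (ha : w a ≤ 0) {t : ℝ} (ht : t ∈ Ioc a b) : w t < 0 := by
  have := pos_of_linear_ode (w := fun t => -w t) (h := fun t => -h t) hc
    (fun t => (hw t).neg.congr_deriv (by ring)) (fun t ht => neg_pos.2 (hh t ht))
    (neg_nonneg.2 ha) ht
  linarith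

/-- A periodic solution of `w' = c w + h`, which takes negative values, is negative where the source
starts to be positive. -/
lemma neg_at_start_of_periodic_linear_ode {w c h : ℝ → ℝ} {a T : ℝ} (hT : 0 < T) (hc : Continuous c)
    (hw : ∀ t, HasDerivAt w (c t * w t + h t) t) (hper : Function.Periodic w T)
    (hpos : ∀ t ∈ Ioo a (a + T / 2), 0 < h t) (hneg : ∀ t ∈ Ioo (a + T / 2) (a + T), h t < 0)
    (hex : ∃ t, w t < 0) : w a < 0 := by
  by_contra! ha
  obtain ⟨t, ht⟩ := hex
  obtain ⟨r, hr, hrt⟩ := hper.exists_mem_Ico hT t a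
  rw [hrt] at ht
  rcases hr.1.eq_or_lt with rfl | har
  · linarith
  -- A negative value in the first half contradicts positivity started at `a`; one in the second
  -- half persists up to `a + T`, where `w` equals `w a`.
  rcases le_or_gt r (a + T / 2) with hle | hlt
  · exact absurd (pos_of_linear_ode hc hw hpos ha ⟨har, hle⟩) ht.not_gt
  · have := neg_of_linear_ode (a := r) (b := a + T) hc hw
      (fun s hs => hneg s ⟨hlt.trans hs.1, hs.2⟩) ht.le ⟨hr.2, le_rfl⟩
    rw [hper a] at this
    linarith

/-- Between a negative and a positive value, a solution of `w' = c w + h` with positive source has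
exactly one sign change. -/
lemma exists_sign_change_of_linear_ode {w c h : ℝ → ℝ} {a b : ℝ} (hab : a ≤ b) (hc : Continuous c)
    (hw : ∀ t, HasDerivAt w (c t * w t + h t) t) (hpos : ∀ t ∈ Ioo a b, 0 < h t)
    (ha : w a < 0) (hb : 0 < w b) :
    ∃ r ∈ Ioo a b, w r = 0 ∧ (∀ t ∈ Ico a r, w t < 0) ∧ ∀ t ∈ Ioc r b, 0 < w t := by
  obtain ⟨r, hr, hwr⟩ := intermediate_value_Ioo hab
    (fun t _ => (hw t).continuousAt.continuousWithinAt) (show (0 : ℝ) ∈ Ioo (w a) (w b) from ⟨ha, hb⟩)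
  refine ⟨r, hr, hwr, fun t ht => ?_, fun t ht => ?_⟩
  · by_contra! h0
    have := pos_of_linear_ode (a := t) (b := r) hc hw
      (fun s hs => hpos s ⟨ht.1.trans_lt hs.1, hs.2.trans hr.2⟩) h0 ⟨ht.2, le_rfl⟩
    exact this.ne' hwr
  · exact pos_of_linear_ode (a := r) (b := b) hc hw
      (fun s hs => hpos s ⟨hr.1.trans hs.1, hs.2⟩) hwr.ge ht

/-- A periodic solution of `w' = c w + h` which takes both signs, with a source that is positive on
the first half of the period and negative on the second half, changes sign exactly once in each. -/
lemma exists_sign_changes_of_periodic_linear_ode {w c h : ℝ → ℝ} {a T : ℝ} (hT : 0 < T)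
    (hc : Continuous c) (hw : ∀ t, HasDerivAt w (c t * w t + h t) t)
    (hper : Function.Periodic w T) (hh : Function.Periodic h T)
    (hpos : ∀ t ∈ Ioo a (a + T / 2), 0 < h t) (hneg : ∀ t ∈ Ioo (a + T / 2) (a + T), h t < 0)
    (hexn : ∃ t, w t < 0) (hexp : ∃ t, 0 < w t) :
    ∃ r ∈ Ioo a (a + T / 2), ∃ s ∈ Ioo (a + T / 2) (a + T), w r = 0 ∧ w s = 0 ∧
      (∀ t ∈ Ico a r, w t < 0) ∧ (∀ t ∈ Ioo r s, 0 < w t) ∧ (∀ t ∈ Ioc s (a + T), w t < 0) := by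
  have hw' : ∀ t, HasDerivAt (fun t => -w t) (c t * -w t + -h t) t := fun t =>
    (hw t).neg.congr_deriv (by ring)
  have h1 : w a < 0 := neg_at_start_of_periodic_linear_ode hT hc hw hper hpos hneg hexn
  -- Same argument for `-w` on the period starting at `a + T / 2`; its second half is the first half
  -- of the original one, shifted by `T`.
  have h2 : -w (a + T / 2) < 0 := by
    refine neg_at_start_of_periodic_linear_ode (w := fun t => -w t) (h := fun t => -h t) hT hc hw'
      (fun t => by simp only [hper t])
      (fun t ht => neg_pos.2 (hneg t ⟨ht.1, by linarith [ht.2]⟩)) (fun t ht => ?_) ?_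
    · have := hpos (t - T) ⟨by linarith [ht.1], by linarith [ht.2]⟩
      rw [hh.sub_eq] at this
      linarith
    · obtain ⟨t, ht⟩ := hexp
      exact ⟨t, neg_neg_of_pos ht⟩
  obtain ⟨r, hr, hr0, hrn, hrp⟩ := exists_sign_change_of_linear_ode (by linarith) hc hw hpos h1
    (neg_neg_iff_pos.1 h2)
  obtain ⟨s, hs, hs0, hsn, hsp⟩ := exists_sign_change_of_linear_ode (w := fun t => -w t)
    (h := fun t => -h t) (a := a + T / 2) (b := a + T) (by linarith) hc hw'
    (fun t ht => neg_pos.2 (hneg t ht)) h2 (by simp only [hper a]; linarith)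
  refine ⟨r, hr, s, hs, hr0, neg_eq_zero.1 hs0, hrn, fun t ht => ?_,
    fun t ht => neg_pos.1 (hsp t ht)⟩
  rcases le_or_gt t (a + T / 2) with hle | hlt
  · exact hrp t ⟨ht.1, hle⟩
  · exact neg_neg_iff_pos.1 (hsn t ⟨hlt.le, ht.2⟩)

/-! ### Periodic solutions by contraction -/

open MeasureTheory BoundedContinuousFunction in
/-- For `L > 0` and a bounded continuous source `h`, the equation `y' = -L y + h` has a bounded
solution `S h`, which depends on `h` in a `1/L`-Lipschitz and translation equivariant way. -/
lemma exists_bounded_solution_operator {L : ℝ} (hL : 0 < L) :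
    ∃ S : (ℝ →ᵇ ℝ) → (ℝ →ᵇ ℝ),
      (∀ h t, HasDerivAt (S h) (-L * S h t + h t) t) ∧
      (∀ h₁ h₂, dist (S h₁) (S h₂) ≤ L⁻¹ * dist h₁ h₂) ∧
      ∀ (T : ℝ) (h₁ h₂ : ℝ →ᵇ ℝ), (∀ t, h₂ t = h₁ (t + T)) → ∀ t, S h₂ t = S h₁ (t + T) := by
  have hexp : ∀ t, IntegrableOn (fun s => Real.exp (L * s)) (Iic t) :=
    fun t => integrableOn_exp_mul_Iic hL t
  have hint : ∀ (h : ℝ →ᵇ ℝ) t, IntegrableOn (fun s => Real.exp (L * s) * h s) (Iic t) :=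
    fun h t => (hexp t).mul_bdd (c := ‖h‖) h.continuous.aestronglyMeasurable
      (Eventually.of_forall h.norm_coe_le_norm)
  have hbound : ∀ (h : ℝ →ᵇ ℝ) t,
      |Real.exp (-(L * t)) * ∫ s in Iic t, Real.exp (L * s) * h s| ≤ L⁻¹ * ‖h‖ := by
    intro h t
    have h1 : ‖∫ s in Iic t, Real.exp (L * s) * h s‖ ≤ ∫ s in Iic t, Real.exp (L * s) * ‖h‖ := by
      refine norm_integral_le_of_norm_le ((hexp t).mul_const _) (Eventually.of_forall fun s => ?_)
      rw [norm_mul, Real.norm_of_nonneg (Real.exp_pos _).le]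
      exact mul_le_mul_of_nonneg_left (h.norm_coe_le_norm s) (Real.exp_pos _).le
    rw [integral_mul_const, integral_exp_mul_Iic hL, Real.norm_eq_abs] at h1
    rw [abs_mul, abs_of_pos (Real.exp_pos _)]
    calc _ ≤ Real.exp (-(L * t)) * (Real.exp (L * t) / L * ‖h‖) :=
          mul_le_mul_of_nonneg_left h1 (Real.exp_pos _).le
      _ = L⁻¹ * ‖h‖ := by
          rw [Real.exp_neg]
          field_simp
  have hderiv : ∀ (h : ℝ →ᵇ ℝ) t,
      HasDerivAt (fun t => Real.exp (-(L * t)) * ∫ s in Iic t, Real.exp (L * s) * h s)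
        (-L * (Real.exp (-(L * t)) * ∫ s in Iic t, Real.exp (L * s) * h s) + h t) t := by
    intro h t
    have hc : Continuous fun s => Real.exp (L * s) * h s := by fun_prop
    have h1 : HasDerivAt (fun t => ∫ s in Iic t, Real.exp (L * s) * h s)
        (Real.exp (L * t) * h t) t := by
      have h2 := (intervalIntegral.integral_hasDerivAt_right (hc.intervalIntegrable 0 t)
        (hc.stronglyMeasurableAtFilter _ _) hc.continuousAt).const_add
          (∫ s in Iic 0, Real.exp (L * s) * h s)
      refine h2.congr_of_eventuallyEq (Eventually.of_forall fun u => ?_)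
      have := intervalIntegral.integral_Iic_sub_Iic (hint h 0) (hint h u)
      simp only
      linarith
    have h3 : HasDerivAt (fun t => Real.exp (-(L * t))) (Real.exp (-(L * t)) * -(L * 1)) t :=
      ((hasDerivAt_id' t).const_mul L).fun_neg.exp
    refine (h3.mul h1).congr_deriv ?_
    have h4 : Real.exp (-(L * t)) * Real.exp (L * t) = 1 := by rw [← Real.exp_add]; simp
    linear_combination h t * h4
  refine ⟨fun h => BoundedContinuousFunction.ofNormedAddCommGroup
    (fun t => Real.exp (-(L * t)) * ∫ s in Iic t, Real.exp (L * s) * h s)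
    (continuous_iff_continuousAt.2 fun t => (hderiv h t).continuousAt) _ (hbound h),
    hderiv, fun h₁ h₂ => ?_, fun T h₁ h₂ hT t => ?_⟩
  · rw [BoundedContinuousFunction.dist_le (by positivity)]
    intro t
    rw [dist_eq_norm h₁ h₂, Real.dist_eq]
    -- The operator is linear, so its Lipschitz bound is its norm bound on the difference.
    convert hbound (h₁ - h₂) t using 2
    simp only [BoundedContinuousFunction.coe_ofNormedAddCommGroup, BoundedContinuousFunction.coe_sub,
      Pi.sub_apply, mul_sub]
    rw [integral_sub (hint h₁ t) (hint h₂ t)]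
    ring
  · have h1 := (measurePreserving_add_right volume T).setIntegral_preimage_emb
      (measurableEmbedding_addRight T) (fun s => Real.exp (L * s) * h₁ s) (Iic (t + T))
    have h2 : (fun x => x + T) ⁻¹' Iic (t + T) = Iic t := by ext x; simp
    simp only [BoundedContinuousFunction.coe_ofNormedAddCommGroup]
    rw [← h1, h2, ← integral_const_mul, ← integral_const_mul]
    refine setIntegral_congr_fun measurableSet_Iic fun s _ => ?_
    simp only [hT]
    rw [← mul_assoc, ← mul_assoc, ← Real.exp_add, ← Real.exp_add]
    ring_nf

open BoundedContinuousFunction in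
/-- If `g` decreases at a rate between `k > 0` and `L`, the equation `y' = g y + p` with periodic
source has a periodic solution. -/
lemma exists_periodic_solution_of_slope_bounds {g p : ℝ → ℝ} {k L T : ℝ} (hk : 0 < k) (hkL : k ≤ L)
    (hg : ∀ a b, a ≤ b → k * (b - a) ≤ g a - g b ∧ g a - g b ≤ L * (b - a)) (hT : 0 < T)
    (hp : Continuous p) (hper : Function.Periodic p T) :
    ∃ y : ℝ → ℝ, Function.Periodic y T ∧ ∀ t, HasDerivAt y (g (y t) + p t) t := by
  have hL : 0 < L := hk.trans_le hkL
  obtain ⟨C, hC⟩ : ∃ C, ∀ t, ‖p t‖ ≤ C := by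
    obtain ⟨s, hs⟩ := Function.Periodic.exists_forall_le (u := fun t => ‖p t‖)
      (fun t => by simp only [hper t]) hT hp.norm
    exact ⟨_, hs⟩
  let P : ℝ →ᵇ ℝ := BoundedContinuousFunction.ofNormedAddCommGroup p hp C hC
  obtain ⟨κ, hκ⟩ : ∃ κ : NNReal, (κ : ℝ) = L - k := ⟨_, Real.coe_toNNReal _ (sub_nonneg.2 hkL)⟩
  obtain ⟨l, hl⟩ : ∃ l : NNReal, (l : ℝ) = L⁻¹ := ⟨_, Real.coe_toNNReal _ (by positivity)⟩
  -- Adding `L x` brings the slopes of `g` from `[-L, -k]` into `[0, L - k]`, so the contraction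
  -- factor below is `(L - k) / L < 1`.
  have hG : LipschitzWith κ fun x => g x + L * x := by
    refine LipschitzWith.of_dist_le_mul fun a b => ?_
    rw [hκ, Real.dist_eq, Real.dist_eq]
    rcases le_total a b with h | h
    · rw [abs_sub_comm a b, abs_of_nonneg (sub_nonneg.2 h), abs_le]
      have := hg a b h
      constructor <;> nlinarith
    · rw [abs_of_nonneg (sub_nonneg.2 h), abs_le]
      have := hg b a h
      constructor <;> nlinarith
  obtain ⟨S, hS, hSd, hSt⟩ := exists_bounded_solution_operator hL
  let Φ : (ℝ →ᵇ ℝ) → (ℝ →ᵇ ℝ) := fun y => S (y.comp _ hG + P)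
  have hΦ : ContractingWith (l * κ) Φ := by
    constructor
    · rw [← NNReal.coe_lt_coe, NNReal.coe_mul, NNReal.coe_one, hl, hκ, inv_mul_lt_iff₀ hL]
      linarith
    · refine LipschitzWith.of_dist_le_mul fun y₁ y₂ => (hSd _ _).trans ?_
      rw [dist_add_right, NNReal.coe_mul, hl, mul_assoc]
      refine mul_le_mul_of_nonneg_left ?_ (by positivity)
      exact (BoundedContinuousFunction.lipschitz_comp hG).dist_le_mul y₁ y₂
  set y := ContractingWith.fixedPoint Φ hΦ
  have hy : Φ y = y := hΦ.fixedPoint_isFixedPt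
  refine ⟨y, ?_, fun t => ?_⟩
  -- The translate of the fixed point by `T` is again a fixed point, hence equal to it.
  · let y' : ℝ →ᵇ ℝ := y.compContinuous ⟨fun t => t + T, by fun_prop⟩
    have hy' : Φ y' = y' := by
      ext t
      have h1 : Φ y' t = Φ y (t + T) := by
        refine hSt T _ _ (fun t => ?_) t
        simp only [BoundedContinuousFunction.add_apply]
        exact congrArg₂ (· + ·) rfl (hper t).symm
      rw [h1, hy]
      rfl
    intro t
    have h2 : y' = y := hΦ.fixedPoint_unique hy'
    exact DFunLike.congr_fun h2 t
  · have h1 : HasDerivAt (Φ y) (-L * Φ y t + (g (y t) + L * y t + p t)) t := hS _ t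
    rw [hy] at h1
    exact h1.congr_deriv (by ring)

/-! ### Quantitative bounds on the law -/

namespace IsCrackLaw

variable {f : ℝ → ℝ} (hf : IsCrackLaw f)

include hf

lemma differentiableAt {y : ℝ} (hy : -1 < y) : DifferentiableAt ℝ f y :=
  (hf.contDiffOn.differentiableOn (by norm_num)).differentiableAt (Ioi_mem_nhds hy)

lemma hasDerivAt {y : ℝ} (hy : -1 < y) : HasDerivAt f (deriv f y) y :=
  (hf.differentiableAt hy).hasDerivAt

lemma contDiffOn_deriv : ContDiffOn ℝ 1 (deriv f) (Ioi (-1)) :=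
  hf.contDiffOn.deriv_of_isOpen isOpen_Ioi (by norm_num)

lemma strictAntiOn : StrictAntiOn f (Ioi (-1)) := by
  refine strictAntiOn_of_deriv_neg (convex_Ioi _) hf.contDiffOn.continuousOn fun y hy => ?_
  rw [interior_Ioi] at hy
  exact hf.deriv_neg y hy

/-- `f'` is continuous and negative, so on a compact interval it stays away from `0` and from `-∞`;
these are the slope bounds needed for the contraction. -/
lemma slope_bounds {m M : ℝ} (hm : -1 < m) (hM : m ≤ M) :
    ∃ k L : ℝ, 0 < k ∧ k ≤ L ∧ ∀ a ∈ Icc m M, ∀ b ∈ Icc m M, a ≤ b →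
      k * (b - a) ≤ f a - f b ∧ f a - f b ≤ L * (b - a) := by
  have hsub : Icc m M ⊆ Ioi (-1) := fun x hx => hm.trans_le hx.1
  have hcd : ContinuousOn (deriv f) (Icc m M) := hf.contDiffOn_deriv.continuousOn.mono hsub
  have hd : DifferentiableOn ℝ f (Icc m M) := fun x hx =>
    (hf.differentiableAt (hsub hx)).differentiableWithinAt
  obtain ⟨x, hx, hxmax⟩ := isCompact_Icc.exists_isMaxOn (nonempty_Icc.2 hM) hcd
  obtain ⟨z, hz, hzmin⟩ := isCompact_Icc.exists_isMinOn (nonempty_Icc.2 hM) hcd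
  refine ⟨-deriv f x, -deriv f z, neg_pos.2 (hf.deriv_neg x (hsub hx)), neg_le_neg (hxmax hz),
    fun a ha b hb hab => ⟨?_, ?_⟩⟩
  · have := (convex_Icc m M).image_sub_le_mul_sub_of_deriv_le hd.continuousOn
      (hd.mono interior_subset) (fun y hy => hxmax (interior_subset hy)) a ha b hb hab
    linarith
  · have := (convex_Icc m M).mul_sub_le_image_sub_of_le_deriv hd.continuousOn
      (hd.mono interior_subset) (fun y hy => hzmin (interior_subset hy)) a ha b hb hab
    linarith

/-- The quadratic Taylor bound of `f` at `0`. -/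
lemma exists_abs_add_self_le : ∃ K, 0 ≤ K ∧ ∀ y, |y| ≤ 1 / 2 → |f y + y| ≤ K * y ^ 2 := by
  have hsub : Icc (-(1 / 2)) (1 / 2 : ℝ) ⊆ Ioi (-1) := fun x hx => lt_of_lt_of_le (by norm_num) hx.1
  have hd2 : ∀ x ∈ Icc (-(1 / 2)) (1 / 2 : ℝ), HasDerivAt (deriv f) (deriv (deriv f) x) x :=
    fun x hx => ((hf.contDiffOn_deriv.differentiableOn (by norm_num)).differentiableAt
      (Ioi_mem_nhds (hsub hx))).hasDerivAt
  have hcd : ContinuousOn (deriv (deriv f)) (Icc (-(1 / 2)) (1 / 2)) :=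
    (hf.contDiffOn_deriv.continuousOn_deriv_of_isOpen isOpen_Ioi le_rfl).mono hsub
  obtain ⟨K, hK⟩ := isCompact_Icc.exists_bound_of_continuousOn hcd
  have h0 : (0 : ℝ) ∈ Icc (-(1 / 2)) (1 / 2 : ℝ) := by constructor <;> norm_num
  have hK0 : 0 ≤ K := (norm_nonneg _).trans (hK 0 h0)
  refine ⟨K, hK0, fun y hy => ?_⟩
  have hseg : ∀ x, |x| ≤ |y| → x ∈ Icc (-(1 / 2)) (1 / 2 : ℝ) := fun x hx => abs_le.1 (hx.trans hy)
  have h1 : ∀ x ∈ Icc (-|y|) |y|, ‖deriv f x + 1‖ ≤ K * |y| := by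
    intro x hx
    have h2 := (convex_Icc (-(1 / 2)) (1 / 2 : ℝ)).norm_image_sub_le_of_norm_hasDerivWithin_le
      (fun x hx => (hd2 x hx).hasDerivWithinAt) hK h0 (hseg x (abs_le.2 hx))
    rw [hf.deriv_zero, sub_neg_eq_add, sub_zero] at h2
    exact h2.trans (mul_le_mul_of_nonneg_left (abs_le.2 hx) hK0)
  have h3 := (convex_Icc (-|y|) |y|).norm_image_sub_le_of_norm_hasDerivWithin_le
    (f := fun x => f x + x) (f' := fun x => deriv f x + 1)
    (fun x hx => ((hf.hasDerivAt (hsub (hseg x (abs_le.2 hx)))).add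
      (hasDerivAt_id' x)).hasDerivWithinAt) h1
    (x := 0) (y := y) ⟨by simp, by simp⟩ (abs_le.1 le_rfl)
  simp only [hf.map_zero, add_zero, sub_zero, Real.norm_eq_abs] at h3
  rwa [mul_assoc, abs_mul_abs_self, ← pow_two] at h3

end IsCrackLaw

/-! ### A priori bound, existence and uniqueness -/

lemma forcingPeriod_pos {ω : ℝ} (hω : 0 < ω) : 0 < forcingPeriod ω :=
  div_pos (by positivity) hω

lemma mul_forcingPeriod {ω : ℝ} (hω : 0 < ω) : ω * forcingPeriod ω = 2 * Real.pi := by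
  unfold forcingPeriod; field_simp

lemma periodic_comp_mul {ω : ℝ} (hω : 0 < ω) {g : ℝ → ℝ} (hg : Function.Periodic g (2 * Real.pi)) :
    Function.Periodic (fun t => g (ω * t)) (forcingPeriod ω) := fun t => by
  simp only [mul_add, mul_forcingPeriod hω, hg _]

/-- A periodic solution of `y' = g y + A sin (ω t)`, where `0` is the only root of `g`, is bounded
by `2 A / ω`. -/
lemma abs_le_of_periodic_solution {g y : ℝ → ℝ} {ω A : ℝ} (hω : 0 < ω) (hA : 0 ≤ A)
    (hg : ∀ t, g (y t) = 0 → y t = 0)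
    (hy : ∀ t, HasDerivAt y (g (y t) + A * Real.sin (ω * t)) t)
    (hper : Function.Periodic y (forcingPeriod ω)) (t : ℝ) : |y t| ≤ 2 * A / ω := by
  have hT := forcingPeriod_pos hω
  -- The cosine absorbs the forcing: `u' = g(y)`, so `y = 0` and `|u| ≤ A / ω` at critical points of
  -- `u`.
  set u : ℝ → ℝ := fun t => y t + A / ω * Real.cos (ω * t) with hu
  have hup : Function.Periodic u (forcingPeriod ω) := fun t => by
    simp only [hu, hper t, periodic_comp_mul hω Real.cos_periodic t]
  have hud : ∀ t, HasDerivAt u (g (y t)) t := fun t => by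
    have h1 : HasDerivAt (fun t => Real.cos (ω * t)) (-Real.sin (ω * t) * (ω * 1)) t :=
      ((hasDerivAt_id' t).const_mul ω).cos
    refine ((hy t).add (h1.const_mul (A / ω))).congr_deriv ?_
    field_simp
    ring
  have hAω : 0 ≤ A / ω := by positivity
  have hcos : ∀ t, |A / ω * Real.cos (ω * t)| ≤ A / ω := fun t => by
    rw [abs_mul, abs_of_nonneg hAω]
    exact mul_le_of_le_one_right hAω (Real.abs_cos_le_one _)
  have h1 := hup.le_of_forall_deriv_eq_zero hT hud (B := A / ω) (fun s hs => by
    simpa only [hu, hg s hs, zero_add] using (abs_le.1 (hcos s)).2) t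
  have h2 := hup.ge_of_forall_deriv_eq_zero hT hud (B := -(A / ω)) (fun s hs => by
    simpa only [hu, hg s hs, zero_add] using (abs_le.1 (hcos s)).1) t
  have h3 := abs_le.1 (hcos t)
  have h4 : 2 * A / ω = 2 * (A / ω) := by ring
  simp only [hu] at h1 h2
  rw [h4, abs_le]
  constructor <;> linarith

/-- The blow-up of `f` at `-1` supplies a lower barrier `m` with `f m > A`, and the a priori bound
supplies the upper one. Off `[m, M]` the law is replaced by lines of slope `-k`, which makes the
contraction argument apply globally. -/
lemma IsCrackLaw.exists_periodicSolution {f : ℝ → ℝ} (hf : IsCrackLaw f) {ω A : ℝ} (hω : 0 < ω)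
    (hA : 0 ≤ A) : ∃ y, IsPeriodicSolution f ω A y := by
  have hT := forcingPeriod_pos hω
  obtain ⟨m, hmA, hm, hm0⟩ : ∃ m, A < f m ∧ -1 < m ∧ m < 0 := by
    have h1 := hf.tendsto_atTop.eventually_gt_atTop A
    have h2 : Ioo (-1 : ℝ) 0 ∈ 𝓝[>] (-1 : ℝ) := Ioo_mem_nhdsGT (by norm_num)
    obtain ⟨m, hm1, hm2⟩ := (h1.and h2).exists
    exact ⟨m, hm1, hm2⟩
  set M := 2 * A / ω with hM
  have hM0 : 0 ≤ M := by positivity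
  have hmM : m ≤ M := hm0.le.trans hM0
  obtain ⟨k, L, hk, hkL, hslope⟩ := hf.slope_bounds hm hmM
  set c : ℝ → ℝ := fun y => max m (min M y) with hc
  have hcmem : ∀ y, c y ∈ Icc m M := fun y => ⟨le_max_left _ _, max_le hmM (min_le_left _ _)⟩
  have hcid : ∀ y ∈ Icc m M, c y = y := fun y hy => by
    simp only [hc, min_eq_right hy.2, max_eq_right hy.1]
  have hcmono : Monotone c := fun a b hab => max_le_max le_rfl (min_le_min le_rfl hab)
  have hclip : ∀ a b, a ≤ b → c b - c a ≤ b - a := fun a b hab => by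
    simp only [hc]
    rcases max_cases m (min M a) with h1 | h1 <;> rcases max_cases m (min M b) with h2 | h2 <;>
      rcases min_cases M a with h3 | h3 <;> rcases min_cases M b with h4 | h4 <;> linarith
  set g : ℝ → ℝ := fun y => f (c y) - k * (y - c y) with hg
  have hgf : ∀ y ∈ Icc m M, g y = f y := fun y hy => by simp only [hg, hcid y hy]; ring
  have hgs : ∀ a b, a ≤ b → k * (b - a) ≤ g a - g b ∧ g a - g b ≤ L * (b - a) := fun a b hab => by
    have h1 := hslope _ (hcmem a) _ (hcmem b) (hcmono hab)
    have h2 := mul_le_mul_of_nonneg_left (hclip a b hab) (sub_nonneg.2 hkL)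
    simp only [hg]
    constructor <;> nlinarith
  have hganti : StrictAnti g := fun a b hab => by
    have := (hgs a b hab.le).1
    have := mul_pos hk (sub_pos.2 hab)
    linarith
  have hg0 : g 0 = 0 := by rw [hgf 0 ⟨hm0.le, hM0⟩, hf.map_zero]
  obtain ⟨y, hper, hy⟩ := exists_periodic_solution_of_slope_bounds hk hkL hgs hT
    (p := fun t => A * Real.sin (ω * t)) (by fun_prop)
    (fun t => by simp only [periodic_comp_mul hω Real.sin_periodic t])
  have hup : ∀ t, y t ≤ M := fun t => (abs_le.1 (abs_le_of_periodic_solution hω hA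
    (fun t ht => hganti.injective (ht.trans hg0.symm)) hy hper t)).2
  -- At a critical point `g (y t) = -A sin (ω t) ≤ A < g m`, and `g` is decreasing.
  have hlow : ∀ t, m ≤ y t := by
    refine hper.ge_of_forall_deriv_eq_zero hT hy fun t ht => ?_
    have h1 : g m = f m := hgf m ⟨le_rfl, hmM⟩
    have h2 : A * -1 ≤ A * Real.sin (ω * t) :=
      mul_le_mul_of_nonneg_left (Real.neg_one_le_sin _) hA
    exact (hganti.lt_iff_gt.1 (show g (y t) < g m by linarith)).le
  refine ⟨y, fun t => hm.trans_le (hlow t), fun t => ?_, hper⟩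
  rw [← hgf (y t) ⟨hlow t, hup t⟩]
  exact hy t

lemma IsPeriodicSolution.unique {f : ℝ → ℝ} (hf : IsCrackLaw f) {ω A : ℝ} (hω : 0 < ω)
    {y₁ y₂ : ℝ → ℝ} (h₁ : IsPeriodicSolution f ω A y₁) (h₂ : IsPeriodicSolution f ω A y₂) :
    y₁ = y₂ := by
  have hT := forcingPeriod_pos hω
  have hper : Function.Periodic (fun t => y₁ t - y₂ t) (forcingPeriod ω) := fun t => by
    simp only [h₁.periodic t, h₂.periodic t]
  have hd := fun t => (h₁.hasDerivAt t).sub (h₂.hasDerivAt t)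
  have hcrit : ∀ t, f (y₁ t) + A * Real.sin (ω * t) - (f (y₂ t) + A * Real.sin (ω * t)) = 0 →
      y₁ t - y₂ t = 0 := fun t ht => sub_eq_zero.2 <|
    hf.strictAntiOn.injOn (h₁.neg_one_lt t) (h₂.neg_one_lt t) (by linarith)
  funext t
  have h3 := hper.le_of_forall_deriv_eq_zero hT hd (fun t ht => (hcrit t ht).le) t
  have h4 := hper.ge_of_forall_deriv_eq_zero hT hd (fun t ht => (hcrit t ht).ge) t
  linarith

/-! ### Signs of the forcing and of its derivative -/

section Location

variable {ω : ℝ} (hω : 0 < ω)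
include hω

lemma sin_mul_pos {t : ℝ} (ht : t ∈ Ioo 0 (forcingPeriod ω / 2)) : 0 < Real.sin (ω * t) := by
  have h := mul_forcingPeriod hω
  have h2 := mul_lt_mul_of_pos_left ht.2 hω
  exact Real.sin_pos_of_pos_of_lt_pi (mul_pos hω ht.1) (by linarith)

lemma sin_mul_neg {t : ℝ} (ht : t ∈ Ioo (forcingPeriod ω / 2) (forcingPeriod ω)) :
    Real.sin (ω * t) < 0 := by
  have h := mul_forcingPeriod hω
  have h3 := sin_mul_pos hω (t := t - forcingPeriod ω / 2)
    ⟨by linarith [ht.1], by linarith [ht.2]⟩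
  have h4 : ω * (t - forcingPeriod ω / 2) = ω * t - Real.pi := by linarith
  rw [h4, Real.sin_sub_pi] at h3
  linarith

lemma cos_mul_pos {t : ℝ} (ht : t ∈ Ioo (-(forcingPeriod ω / 4)) (forcingPeriod ω / 4)) :
    0 < Real.cos (ω * t) := by
  have h := mul_forcingPeriod hω
  have h1 := mul_lt_mul_of_pos_left ht.1 hω
  have h2 := mul_lt_mul_of_pos_left ht.2 hω
  exact Real.cos_pos_of_mem_Ioo ⟨by linarith, by linarith⟩

lemma cos_mul_neg {t : ℝ} (ht : t ∈ Ioo (forcingPeriod ω / 4) (3 * forcingPeriod ω / 4)) :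
    Real.cos (ω * t) < 0 := by
  have h := mul_forcingPeriod hω
  have h1 := mul_lt_mul_of_pos_left ht.1 hω
  have h2 := mul_lt_mul_of_pos_left ht.2 hω
  exact Real.cos_neg_of_pi_div_two_lt_of_lt (by linarith) (by linarith)

end Location

/-! ### Roots and extrema of the periodic solution -/

namespace IsPeriodicSolution

variable {f : ℝ → ℝ} (hf : IsCrackLaw f) {ω A : ℝ} {y : ℝ → ℝ} (hy : IsPeriodicSolution f ω A y)

include hy in
lemma continuous : Continuous y :=
  continuous_iff_continuousAt.2 fun t => (hy.hasDerivAt t).continuousAt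

include hy in
lemma periodic_deriv (hω : 0 < ω) :
    Function.Periodic (fun t => f (y t) + A * Real.sin (ω * t)) (forcingPeriod ω) := fun t => by
  simp only [hy.periodic t, periodic_comp_mul hω Real.sin_periodic t]

include hf hy

/-- Since `f 0 = 0`, `f(y)` is `y` times the slope of `f` between `0` and `y`: the equation becomes
linear along the solution, with the forcing as source. -/
lemma hasDerivAt_linear (t : ℝ) :
    HasDerivAt y (dslope f 0 (y t) * y t + A * Real.sin (ω * t)) t := by
  have h := sub_smul_dslope f 0 (y t)
  rw [hf.map_zero, sub_zero, sub_zero, smul_eq_mul] at h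
  rw [mul_comm, h]
  exact hy.hasDerivAt t

lemma continuous_dslope : Continuous fun t => dslope f 0 (y t) := by
  have h : ContinuousOn (dslope f 0) (Ioi (-1)) :=
    (continuousOn_dslope (Ioi_mem_nhds (by norm_num))).2
      ⟨hf.contDiffOn.continuousOn, hf.differentiableAt (by norm_num)⟩
  exact h.comp_continuous hy.continuous hy.neg_one_lt

/-- Differentiating the equation shows that `y'` also solves a linear equation, with a source a
quarter period ahead of the forcing. -/
lemma hasDerivAt_deriv (t : ℝ) :
    HasDerivAt (fun t => f (y t) + A * Real.sin (ω * t))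
      (deriv f (y t) * (f (y t) + A * Real.sin (ω * t)) + A * ω * Real.cos (ω * t)) t := by
  have h1 : HasDerivAt (fun t => Real.sin (ω * t)) (Real.cos (ω * t) * (ω * 1)) t :=
    ((hasDerivAt_id' t).const_mul ω).sin
  exact (((hf.hasDerivAt (hy.neg_one_lt t)).comp t (hy.hasDerivAt t)).add
    (h1.const_mul A)).congr_deriv (by ring)

lemma continuous_deriv_comp : Continuous fun t => deriv f (y t) :=
  hf.contDiffOn_deriv.continuousOn.comp_continuous hy.continuous hy.neg_one_lt

lemma map_neg {t : ℝ} (ht : 0 < y t) : f (y t) < 0 :=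
  hf.map_zero ▸ hf.strictAntiOn (by norm_num) (hy.neg_one_lt t) ht

lemma map_pos {t : ℝ} (ht : y t < 0) : 0 < f (y t) :=
  hf.map_zero ▸ hf.strictAntiOn (hy.neg_one_lt t) (by norm_num) ht

omit hf hy in
lemma hasDerivAt_add_cos (hω : 0 < ω) (hy : IsPeriodicSolution f ω A y) (t : ℝ) :
    HasDerivAt (fun t => y t + A / ω * Real.cos (ω * t)) (f (y t)) t := by
  have h1 : HasDerivAt (fun t => Real.cos (ω * t)) (-Real.sin (ω * t) * (ω * 1)) t :=
    ((hasDerivAt_id' t).const_mul ω).cos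
  refine ((hy.hasDerivAt t).add (h1.const_mul (A / ω))).congr_deriv ?_
  field_simp
  ring

/-- For `A > 0`, the periodic solution takes both signs. -/
lemma exists_neg_and_exists_pos (hω : 0 < ω) (hA : 0 < A) : (∃ t, y t < 0) ∧ ∃ t, 0 < y t := by
  have hT := forcingPeriod_pos hω
  have hu := hasDerivAt_add_cos hω hy
  have hup : Function.Periodic (fun t => y t + A / ω * Real.cos (ω * t)) (forcingPeriod ω) :=
    fun t => by simp only [hy.periodic t, periodic_comp_mul hω Real.cos_periodic t]
  -- Otherwise `y` vanishes identically, and the equation fails at `T / 4`, where the forcing is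
  -- positive.
  have hne : ¬ ∀ t, f (y t) = 0 := fun h => by
    have h0 : ∀ t, y t = 0 := fun t => hf.strictAntiOn.injOn (hy.neg_one_lt t)
      (show (0 : ℝ) ∈ Ioi (-1 : ℝ) by norm_num) ((h t).trans hf.map_zero.symm)
    have h1 := hy.hasDerivAt (forcingPeriod ω / 4)
    rw [funext h0] at h1
    have h2 := h1.unique (hasDerivAt_const _ (0 : ℝ))
    have h3 := mul_pos hA (sin_mul_pos hω (t := forcingPeriod ω / 4) ⟨by linarith, by linarith⟩)
    rw [hf.map_zero] at h2
    linarith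
  constructor <;> by_contra! hcon
  · refine hne fun t => neg_eq_zero.1 ?_
    refine Function.Periodic.deriv_eq_zero_of_nonneg (u' := fun t => -f (y t))
      (u := fun t => -(y t + A / ω * Real.cos (ω * t)))
      (fun t => congrArg Neg.neg (hup t)) hT (fun t => (hu t).fun_neg) (fun t => neg_nonneg.2 ?_) t
    rcases (hcon t).eq_or_lt with h | h
    · rw [← h, hf.map_zero]
    · exact (map_neg hf hy h).le
  · refine hne (hup.deriv_eq_zero_of_nonneg hT hu fun t => ?_)
    rcases (hcon t).eq_or_lt with h | h
    · rw [h, hf.map_zero]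
    · exact (map_pos hf hy h).le

/-- For `A > 0`, the derivative of `y` does not have a constant sign. -/
lemma exists_deriv_neg_and_exists_deriv_pos (hω : 0 < ω) (hA : 0 < A) :
    (∃ t, f (y t) + A * Real.sin (ω * t) < 0) ∧ ∃ t, 0 < f (y t) + A * Real.sin (ω * t) := by
  have hT := forcingPeriod_pos hω
  -- Otherwise the differentiated equation at `t = 0` reads `A ω = 0`.
  have hne : ¬ ∀ t, f (y t) + A * Real.sin (ω * t) = 0 := fun h => by
    have h1 := hasDerivAt_deriv hf hy 0
    rw [h 0, funext h] at h1
    have h2 := h1.unique (hasDerivAt_const _ (0 : ℝ))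
    have h3 := mul_pos hA hω
    simp at h2
    rcases h2 with h2 | h2 <;> linarith
  constructor <;> by_contra! hcon
  · exact hne (hy.periodic.deriv_eq_zero_of_nonneg hT hy.hasDerivAt hcon)
  · refine hne fun t => neg_eq_zero.1 ?_
    exact Function.Periodic.deriv_eq_zero_of_nonneg (u := fun t => -y t)
      (u' := fun t => -(f (y t) + A * Real.sin (ω * t)))
      (fun t => congrArg Neg.neg (hy.periodic t)) hT (fun t => (hy.hasDerivAt t).fun_neg)
      (fun t => neg_nonneg.2 (hcon t)) t

/-- The zeros `p < q` of `y'` split a period into an increasing branch `[p, q]` and a decreasing one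
`[q, p + T]`; the minimum in `[0, T]` is at `p + T`, as `p` turns out to be negative. -/
lemma exists_areCriticalTimes (hω : 0 < ω) (hA : 0 < A) : ∃ t₁ t₂ tmax tmin,
    AreCriticalTimes (forcingPeriod ω) y t₁ t₂ tmax tmin := by
  have hT := forcingPeriod_pos hω
  have hωT := mul_forcingPeriod hω
  obtain ⟨hyn, hyp⟩ := exists_neg_and_exists_pos hf hy hω hA
  obtain ⟨hzn, hzp⟩ := exists_deriv_neg_and_exists_deriv_pos hf hy hω hA
  obtain ⟨r, hr, s, hs, hr0, hs0, hneg₁, hpos, hneg₂⟩ :=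
    exists_sign_changes_of_periodic_linear_ode (h := fun t => A * Real.sin (ω * t)) (a := 0)
      hT (continuous_dslope hf hy) (hasDerivAt_linear hf hy) hy.periodic
      (fun t => by simp only [periodic_comp_mul hω Real.sin_periodic t])
      (fun t ht => mul_pos hA (sin_mul_pos hω (by simpa using ht)))
      (fun t ht => mul_neg_of_pos_of_neg hA (sin_mul_neg hω (by simpa using ht))) hyn hyp
  -- The period starts at `-T / 4` because the source `Aω cos ωt` is positive on the half-period
  -- that follows.
  obtain ⟨p, hp, q, hq, hp0, hq0, hzneg₁, hzpos, hzneg₂⟩ :=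
    exists_sign_changes_of_periodic_linear_ode (h := fun t => A * ω * Real.cos (ω * t))
      (a := -(forcingPeriod ω / 4)) hT (continuous_deriv_comp hf hy) (hasDerivAt_deriv hf hy)
      (hy.periodic_deriv hω) (fun t => by simp only [periodic_comp_mul hω Real.cos_periodic t])
      (fun t ht => mul_pos (mul_pos hA hω) (cos_mul_pos hω ⟨ht.1, by linarith [ht.2]⟩))
      (fun t ht => mul_neg_of_pos_of_neg (mul_pos hA hω)
        (cos_mul_neg hω ⟨by linarith [ht.1], by linarith [ht.2]⟩)) hzn hzp
  set T := forcingPeriod ω with hTdef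
  simp only [zero_add] at hr hs hneg₂
  have hp1 : -(T / 4) < p := hp.1
  have hp2 : p < T / 4 := by linarith [hp.2]
  have hq1 : T / 4 < q := by linarith [hq.1]
  have hq2 : q < 3 * T / 4 := by linarith [hq.2]
  have hmono : StrictMonoOn y (Icc p q) := by
    refine strictMonoOn_of_deriv_pos (convex_Icc _ _) hy.continuous.continuousOn fun t ht => ?_
    rw [interior_Icc] at ht
    rw [(hy.hasDerivAt t).deriv]
    exact hzpos t ht
  have hanti : StrictAntiOn y (Icc q (p + T)) := by
    refine strictAntiOn_of_deriv_neg (convex_Icc _ _) hy.continuous.continuousOn fun t ht => ?_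
    rw [interior_Icc] at ht
    rw [(hy.hasDerivAt t).deriv]
    rcases le_or_gt t (3 * T / 4) with h | h
    · exact hzneg₂ t ⟨ht.1, by linarith⟩
    · have := hzneg₁ (t - T) ⟨by linarith, by linarith [ht.2]⟩
      rwa [(hy.periodic_deriv hω).sub_eq] at this
  have hpT : y (p + T) = y p := hy.periodic p
  have hlt_q : ∀ t ∈ Icc p (p + T), t ≠ q → y t < y q := fun t ht hne => by
    rcases hne.lt_or_gt with h | h
    · exact hmono ⟨ht.1, h.le⟩ ⟨by linarith, le_rfl⟩ h
    · exact hanti ⟨le_rfl, by linarith⟩ ⟨h.le, ht.2⟩ h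
  have hp_lt : ∀ t ∈ Ioo p (p + T), y p < y t := fun t ht => by
    rcases le_or_gt t q with h | h
    · exact hmono ⟨le_rfl, by linarith⟩ ⟨ht.1.le, h⟩ ht.1
    · rw [← hpT]
      exact hanti ⟨h.le, ht.2.le⟩ ⟨by linarith, le_rfl⟩ ht.2
  have hyq : 0 < y q := by
    have h1 := hpos (T / 2) ⟨hr.2, hs.1⟩
    rcases eq_or_ne (T / 2) q with h | h
    · rwa [← h]
    · exact h1.trans (hlt_q (T / 2) ⟨by linarith, by linarith⟩ h)
  -- At the maximum `f (y q) < 0`, so `y' = 0` requires a positive sine.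
  have hq3 : q < T / 2 := by
    by_contra! h
    have h1 : Real.sin (ω * q) ≤ 0 := by
      rcases h.eq_or_lt with h | h
      · rw [← h, show ω * (T / 2) = Real.pi by linarith, Real.sin_pi]
      · exact (sin_mul_neg hω ⟨h, by linarith⟩).le
    have h2 := map_neg hf hy hyq
    have h3 := mul_nonpos_of_nonneg_of_nonpos hA.le h1
    linarith
  have hy0 : y 0 < 0 := hneg₁ 0 ⟨le_rfl, hr.1⟩
  have hyp : y p < 0 := by
    rcases lt_trichotomy p 0 with h | h | h
    · exact (hp_lt 0 ⟨h, by linarith⟩).trans hy0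
    · rwa [h]
    · have h1 := hp_lt T ⟨by linarith, by linarith⟩
      rw [hy.periodic.eq] at h1
      exact h1.trans hy0
  -- At the minimum `f (y p) > 0`, so `y' = 0` requires a negative sine.
  have hp3 : p < 0 := by
    by_contra! h
    have h1 : 0 ≤ Real.sin (ω * p) := by
      rcases h.eq_or_lt with h | h
      · rw [← h, mul_zero, Real.sin_zero]
      · exact (sin_mul_pos hω ⟨h, by linarith⟩).le
    have h2 := map_pos hf hy hyp
    have h3 := mul_nonneg hA.le h1
    linarith
  have hsign : ∀ t ∈ Icc 0 T, t = r ∨ t = s ∨ (y t < 0 ∧ (t < r ∨ s < t)) ∨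
      (0 < y t ∧ r < t ∧ t < s) := fun t ht => by
    rcases lt_trichotomy t r with h | h | h
    · exact .inr (.inr (.inl ⟨hneg₁ t ⟨ht.1, h⟩, .inl h⟩))
    · exact .inl h
    rcases lt_trichotomy t s with h' | h' | h'
    · exact .inr (.inr (.inr ⟨hpos t ⟨h, h'⟩, h, h'⟩))
    · exact .inr (.inl h')
    · exact .inr (.inr (.inl ⟨hneg₂ t ⟨h', ht.2⟩, .inr h'⟩))
  have hsq : r < q ∧ q < s := by
    rcases hsign q ⟨by linarith, by linarith⟩ with h | h | h | h
    · rw [h] at hyq; linarith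
    · rw [h] at hyq; linarith
    · linarith [h.1]
    · exact h.2
  have hsp : s < p + T := by
    rcases hsign (p + T) ⟨by linarith, by linarith⟩ with h | h | h | h
    · linarith [hr.2]
    · rw [← hpT, h] at hyp; linarith
    · rcases h.2 with h | h
      · linarith [hr.2]
      · exact h
    · linarith [h.1]
  refine ⟨r, s, q, p + T, ⟨?_, hyq, fun t ht hne => ?_, by rwa [hpT], fun t ht hne => ?_,
    ⟨hr.1, hr.2, hs.1, hs.2⟩, ⟨hsq.1, hsq.2, hsp⟩, ⟨hq1, hq3⟩, ⟨by linarith, by linarith⟩⟩⟩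
  · ext t
    simp only [mem_ofPred_eq, mem_insert_iff, mem_singleton_iff]
    constructor
    · rintro ⟨ht, h0⟩
      rcases hsign t ht with h | h | h | h
      · exact .inl h
      · exact .inr h
      · linarith [h.1]
      · linarith [h.1]
    · rintro (rfl | rfl)
      · exact ⟨⟨hr.1.le, by linarith [hr.2]⟩, hr0⟩
      · exact ⟨⟨by linarith [hs.1], hs.2.le⟩, hs0⟩
  · rcases le_or_gt t (p + T) with h | h
    · exact hlt_q t ⟨by linarith [ht.1], h⟩ hne
    · rw [← hy.periodic.sub_eq t]
      exact hlt_q _ ⟨by linarith, by linarith [ht.2]⟩ (by linarith [ht.2])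
  · rw [hpT]
    rcases hne.lt_or_gt with h | h
    · exact hp_lt t ⟨by linarith [ht.1], h⟩
    · rw [← hy.periodic.sub_eq t]
      exact hp_lt _ ⟨by linarith, by linarith [ht.2]⟩

end IsPeriodicSolution

/-! ### Small-amplitude expansion -/

/-- The linear response `A / √(1 + ω²) * sin (ω t - arctan ω)` solves `η' = -η + A sin (ω t)`. -/
lemma hasDerivAt_linear_response (ω A t : ℝ) :
    HasDerivAt (fun t => A / Real.sqrt (1 + ω ^ 2) * Real.sin (ω * t - Real.arctan ω))
      (A / Real.sqrt (1 + ω ^ 2) * (ω * Real.cos (ω * t - Real.arctan ω))) t := by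
  have h : HasDerivAt (fun t => Real.sin (ω * t - Real.arctan ω))
      (Real.cos (ω * t - Real.arctan ω) * (ω * 1)) t :=
    (((hasDerivAt_id' t).const_mul ω).sub_const _).sin
  exact (h.const_mul _).congr_deriv (by ring)

lemma linear_response_eq (ω A t : ℝ) :
    A / Real.sqrt (1 + ω ^ 2) * (ω * Real.cos (ω * t - Real.arctan ω)) =
      -(A / Real.sqrt (1 + ω ^ 2) * Real.sin (ω * t - Real.arctan ω)) + A * Real.sin (ω * t) := by
  have hD : Real.sqrt (1 + ω ^ 2) ≠ 0 := (Real.sqrt_pos.2 (by positivity)).ne'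
  have hD2 : Real.sqrt (1 + ω ^ 2) ^ 2 = 1 + ω ^ 2 := Real.sq_sqrt (by positivity)
  rw [Real.cos_sub, Real.sin_sub, Real.cos_arctan, Real.sin_arctan]
  field_simp
  linear_combination -A * Real.sin (ω * t) * hD2

/-- The solution and its derivative agree with the linear response up to `O(A²)`. -/
lemma IsCrackLaw.exists_linear_response_bound {f : ℝ → ℝ} (hf : IsCrackLaw f) {ω : ℝ}
    (hω : 0 < ω) : ∃ C δ : ℝ, 0 ≤ C ∧ 0 < δ ∧ ∀ A, 0 ≤ A → A ≤ δ → ∀ y, IsPeriodicSolution f ω A y →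
      ∀ t, |y t - A / Real.sqrt (1 + ω ^ 2) * Real.sin (ω * t - Real.arctan ω)| ≤ C * A ^ 2 ∧
        |f (y t) + A * Real.sin (ω * t) -
          A / Real.sqrt (1 + ω ^ 2) * (ω * Real.cos (ω * t - Real.arctan ω))| ≤ 2 * C * A ^ 2 := by
  obtain ⟨K, hK, hfK⟩ := hf.exists_abs_add_self_le
  -- `δ = ω / 4` turns `|y| ≤ 2A / ω` into `|y| ≤ 1 / 2`, where the Taylor bound holds; `C` is that
  -- bound evaluated at `2A / ω`, divided by `A²`.
  refine ⟨K * (2 / ω) ^ 2, ω / 4, by positivity, by positivity, fun A hA hAδ y hy => ?_⟩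
  have hT := forcingPeriod_pos hω
  have hyb : ∀ t, |y t| ≤ 2 * A / ω := abs_le_of_periodic_solution hω hA (fun t ht =>
    hf.strictAntiOn.injOn (hy.neg_one_lt t) (show (0 : ℝ) ∈ Ioi (-1 : ℝ) by norm_num)
      (ht.trans hf.map_zero.symm)) hy.hasDerivAt hy.periodic
  have hR : ∀ t, |f (y t) + y t| ≤ K * (2 / ω) ^ 2 * A ^ 2 := fun t => by
    refine (hfK _ ((hyb t).trans ?_)).trans ?_
    · rw [div_le_iff₀ hω]; linarith
    · rw [mul_assoc, ← mul_pow, ← sq_abs, show 2 / ω * A = 2 * A / ω by ring]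
      have := hyb t
      gcongr
  have hper : Function.Periodic
      (fun t => y t - A / Real.sqrt (1 + ω ^ 2) * Real.sin (ω * t - Real.arctan ω))
      (forcingPeriod ω) := fun t => by
    simp only [hy.periodic t]
    rw [mul_add, mul_forcingPeriod hω, add_sub_right_comm, Real.sin_add_two_pi]
  have hd := fun t => (hy.hasDerivAt t).fun_sub (hasDerivAt_linear_response ω A t)
  have hcrit := fun t (ht : f (y t) + A * Real.sin (ω * t) -
      A / Real.sqrt (1 + ω ^ 2) * (ω * Real.cos (ω * t - Real.arctan ω)) = 0) =>
    show y t - A / Real.sqrt (1 + ω ^ 2) * Real.sin (ω * t - Real.arctan ω) = f (y t) + y t by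
      linarith [linear_response_eq ω A t]
  intro t
  have h0 : |y t - A / Real.sqrt (1 + ω ^ 2) * Real.sin (ω * t - Real.arctan ω)| ≤
      K * (2 / ω) ^ 2 * A ^ 2 := abs_le.2
    ⟨hper.ge_of_forall_deriv_eq_zero hT hd
      (fun t ht => (abs_le.1 (hR t)).1.trans_eq (hcrit t ht).symm) t,
    hper.le_of_forall_deriv_eq_zero hT hd
      (fun t ht => (hcrit t ht).trans_le (abs_le.1 (hR t)).2) t⟩
  refine ⟨h0, ?_⟩
  -- The error on the derivative is the Taylor remainder minus the error on `y`, each at most `C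
  -- A²`: hence the factor `2`.
  have h1 := abs_le.1 (hR t)
  have h2 := abs_le.1 h0
  have h3 := linear_response_eq ω A t
  rw [abs_le]
  constructor <;> linarith

/-! ### Limits of the critical times -/

/-- A family of points of a compact interval whose phases have sines tending to `0` tends to the
only point of the interval whose phase has a vanishing sine. -/
lemma tendsto_of_tendsto_sin {τ : ℝ → ℝ} {l : Filter ℝ} {ω φ a b x : ℝ} {n : ℕ}
    (hτ : ∀ᶠ A in l, τ A ∈ Icc a b) (hsin : Tendsto (fun A => Real.sin (ω * τ A + φ)) l (𝓝 0))
    (hx : ω * x + φ = n * Real.pi) (hω : 0 < ω) (ha : ω * x - Real.pi < ω * a)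
    (hb : ω * b < ω * x + Real.pi) : Tendsto τ l (𝓝 x) := by
  refine isCompact_Icc.tendsto_nhds_of_unique_mapClusterPt hτ fun t ht hcl => ?_
  have h1 : MapClusterPt (Real.sin (ω * t + φ)) l fun A => Real.sin (ω * τ A + φ) :=
    hcl.continuousAt_comp (f := fun t => Real.sin (ω * t + φ)) (by fun_prop)
  have h2 : Real.sin (ω * t + φ) = 0 := by
    have h3 : ClusterPt (Real.sin (ω * t + φ)) (𝓝 (0 : ℝ)) := h1.clusterPt.mono hsin
    by_contra h4
    exact h3.ne (disjoint_iff.1 (disjoint_nhds_nhds.2 h4))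
  -- Every cluster point has a phase within less than `π` of that of `x`, so a vanishing sine leaves
  -- only `x`.
  have h5 : Real.sin (ω * t - ω * x) = 0 := by
    rw [show ω * t - ω * x = (ω * t + φ) - n * Real.pi by linarith, Real.sin_sub, h2,
      Real.sin_nat_mul_pi]
    ring
  have h6 := mul_le_mul_of_nonneg_left ht.1 hω.le
  have h7 := mul_le_mul_of_nonneg_left ht.2 hω.le
  rw [Real.sin_eq_zero_iff_of_lt_of_lt (by linarith) (by linarith), sub_eq_zero] at h5
  exact mul_left_cancel₀ hω.ne' h5

namespace AreCriticalTimes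

variable {T t₁ t₂ tmax tmin : ℝ} {y : ℝ → ℝ}

lemma isLocalMax (h : AreCriticalTimes T y t₁ t₂ tmax tmin) : IsLocalMax y tmax := by
  have h1 := h.max_mem
  have hmem : Icc 0 T ∈ 𝓝 tmax := Icc_mem_nhds (by linarith [h1.1, h1.2]) (by linarith [h1.1, h1.2])
  filter_upwards [hmem] with t ht
  rcases eq_or_ne t tmax with rfl | hne
  · exact le_rfl
  · exact (h.lt_max t ht hne).le

lemma isLocalMin (h : AreCriticalTimes T y t₁ t₂ tmax tmin) : IsLocalMin y tmin := by
  have h1 := h.min_mem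
  have hmem : Icc 0 T ∈ 𝓝 tmin := Icc_mem_nhds (by linarith [h1.1, h1.2]) h1.2
  filter_upwards [hmem] with t ht
  rcases eq_or_ne t tmin with rfl | hne
  · exact le_rfl
  · exact (h.min_lt t ht hne).le

lemma map_root₁ (h : AreCriticalTimes T y t₁ t₂ tmax tmin) : y t₁ = 0 :=
  (h.roots.symm ▸ mem_insert _ _ : t₁ ∈ {t | t ∈ Icc 0 T ∧ y t = 0}).2

lemma map_root₂ (h : AreCriticalTimes T y t₁ t₂ tmax tmin) : y t₂ = 0 :=
  (h.roots.symm ▸ mem_insert_of_mem _ rfl : t₂ ∈ {t | t ∈ Icc 0 T ∧ y t = 0}).2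

end AreCriticalTimes

/-- A quantity whose product with `c A` is `O(A²)` tends to `0` with `A`. -/
lemma tendsto_zero_of_abs_mul_le_sq {g : ℝ → ℝ} {c C δ : ℝ} (hc : 0 < c) (hδ : 0 < δ)
    (h : ∀ A, 0 < A → A ≤ δ → |c * A * g A| ≤ C * A ^ 2) : Tendsto g (𝓝[>] 0) (𝓝 0) := by
  have hlim : Tendsto (fun A => C / c * A) (𝓝[>] 0) (𝓝 0) := by
    have : Tendsto (fun A => C / c * A) (𝓝 0) (𝓝 (C / c * 0)) :=
      (continuous_const.mul continuous_id).tendsto 0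
    rw [mul_zero] at this
    exact this.mono_left nhdsWithin_le_nhds
  refine squeeze_zero_norm' ?_ hlim
  filter_upwards [Ioc_mem_nhdsGT hδ] with A hA
  have h1 := h A hA.1 hA.2
  have hcA : 0 < c * A := mul_pos hc hA.1
  rw [abs_mul, abs_of_pos hcA] at h1
  rw [Real.norm_eq_abs, div_mul_eq_mul_div, le_div_iff₀ hc]
  refine le_of_mul_le_mul_left ?_ hA.1
  linarith

theorem proposition5p2 (f : ℝ → ℝ) (hf : IsCrackLaw f) (ω : ℝ) (hω : 0 < ω) :
    ∃ Y : ℝ → ℝ → ℝ,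
      -- for every `A ≥ 0`, `Y A` is the unique `T`-periodic solution
      (∀ A : ℝ, 0 ≤ A → ∀ y : ℝ → ℝ, IsPeriodicSolution f ω A y ↔ y = Y A) ∧
      ∃ t₁ t₂ tmax tmin : ℝ → ℝ,
        (∀ A : ℝ, 0 < A →
          AreCriticalTimes (forcingPeriod ω) (Y A) (t₁ A) (t₂ A) (tmax A) (tmin A)) ∧
        (∃ C δ : ℝ, 0 < δ ∧ ∀ A : ℝ, 0 ≤ A → A ≤ δ → ∀ t : ℝ,
          |Y A t - A / Real.sqrt (1 + ω ^ 2) * Real.sin (ω * t - Real.arctan ω)| ≤ C * A ^ 2) ∧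
        Tendsto t₁ (𝓝[>] 0) (𝓝 (Real.arctan ω / ω)) ∧
        Tendsto tmax (𝓝[>] 0) (𝓝 (Real.arctan ω / ω + forcingPeriod ω / 4)) ∧
        Tendsto t₂ (𝓝[>] 0) (𝓝 (Real.arctan ω / ω + forcingPeriod ω / 2)) ∧
        Tendsto tmin (𝓝[>] 0) (𝓝 (Real.arctan ω / ω + 3 * forcingPeriod ω / 4)) := by
  have hY : ∀ A : ℝ, ∃ y, 0 ≤ A → IsPeriodicSolution f ω A y := fun A => by
    by_cases hA : 0 ≤ A
    · exact (hf.exists_periodicSolution hω hA).imp fun y hy _ => hy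
    · exact ⟨0, fun h => absurd h hA⟩
  choose Y hY using hY
  have hcrit : ∀ A : ℝ, ∃ t₁ t₂ tmax tmin, 0 < A →
      AreCriticalTimes (forcingPeriod ω) (Y A) t₁ t₂ tmax tmin := fun A => by
    by_cases hA : 0 < A
    · obtain ⟨a, b, c, d, h⟩ := (hY A hA.le).exists_areCriticalTimes hf hω hA
      exact ⟨a, b, c, d, fun _ => h⟩
    · exact ⟨0, 0, 0, 0, fun h => absurd h hA⟩
  choose t₁ t₂ tmax tmin hcrit using hcrit
  obtain ⟨C, δ, -, hδ, hbound⟩ := hf.exists_linear_response_bound hω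
  refine ⟨Y, fun A hA y => ⟨fun h => IsPeriodicSolution.unique hf hω h (hY A hA),
    fun h => h ▸ hY A hA⟩, t₁, t₂, tmax, tmin, hcrit,
    ⟨C, δ, hδ, fun A hA hAδ t => (hbound A hA hAδ (Y A) (hY A hA) t).1⟩, ?_⟩
  have hD : 0 < Real.sqrt (1 + ω ^ 2) := Real.sqrt_pos.2 (by positivity)
  have hωT := mul_forcingPeriod hω
  have hθ0 : 0 < Real.arctan ω := Real.arctan_pos.2 hω
  have hθ1 := Real.arctan_lt_pi_div_two ω
  have hθω : ω * (Real.arctan ω / ω) = Real.arctan ω := mul_div_cancel₀ _ hω.ne'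
  have hpi := Real.pi_pos
  have hroot : ∀ τ : ℝ → ℝ, (∀ A, 0 < A → Y A (τ A) = 0) →
      Tendsto (fun A => Real.sin (ω * τ A + -Real.arctan ω)) (𝓝[>] 0) (𝓝 0) := fun τ hτ => by
    refine tendsto_zero_of_abs_mul_le_sq (inv_pos.2 hD) hδ (C := C) fun A hA hAδ => ?_
    have h := (hbound A hA.le hAδ _ (hY A hA.le) (τ A)).1
    rwa [hτ A hA, zero_sub, abs_neg, div_eq_inv_mul, sub_eq_add_neg] at h
  have hextr : ∀ τ : ℝ → ℝ, (∀ A, 0 < A → f (Y A (τ A)) + A * Real.sin (ω * τ A) = 0) →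
      Tendsto (fun A => Real.sin (ω * τ A + (Real.pi / 2 - Real.arctan ω))) (𝓝[>] 0) (𝓝 0) :=
    fun τ hτ => by
      refine tendsto_zero_of_abs_mul_le_sq (div_pos hω hD) hδ (C := 2 * C) fun A hA hAδ => ?_
      have h := (hbound A hA.le hAδ _ (hY A hA.le) (τ A)).2
      rw [hτ A hA, zero_sub, abs_neg] at h
      -- A quarter-turn writes the cosine of the derivative estimate as a sine, so one limit lemma
      -- serves roots and extrema.
      rw [show ω * τ A + (Real.pi / 2 - Real.arctan ω) = ω * τ A - Real.arctan ω + Real.pi / 2 by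
        ring, Real.sin_add_pi_div_two]
      convert h using 2
      ring
  have hev : ∀ {P : ℝ → Prop}, (∀ A, 0 < A → P A) → ∀ᶠ A in 𝓝[>] (0 : ℝ), P A :=
    fun h => eventually_nhdsWithin_of_forall h
  refine ⟨?_, ?_, ?_, ?_⟩
  -- Here and below, `n * π` is the value of the shifted phase at the limit: `0` and `π` for the
  -- roots, `π` and `2π` for the maximum and the minimum.
  · refine tendsto_of_tendsto_sin (a := 0) (b := forcingPeriod ω / 2) (n := 0)
      (hev fun A hA => ⟨(hcrit A hA).roots_order.1.le, (hcrit A hA).roots_order.2.1.le⟩)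
      (hroot t₁ fun A hA => (hcrit A hA).map_root₁) ?_ hω ?_ ?_
    · rw [hθω]; simp
    · linarith
    · linarith
  · refine tendsto_of_tendsto_sin (a := forcingPeriod ω / 4) (b := forcingPeriod ω / 2) (n := 1)
      (hev fun A hA => Ioo_subset_Icc_self (hcrit A hA).max_mem)
      (hextr tmax fun A hA =>
        (hcrit A hA).isLocalMax.hasDerivAt_eq_zero ((hY A hA.le).hasDerivAt _)) ?_ hω ?_ ?_
    · push_cast; linarith
    · linarith
    · linarith
  · refine tendsto_of_tendsto_sin (a := forcingPeriod ω / 2) (b := forcingPeriod ω) (n := 1)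
      (hev fun A hA => ⟨(hcrit A hA).roots_order.2.2.1.le, (hcrit A hA).roots_order.2.2.2.le⟩)
      (hroot t₂ fun A hA => (hcrit A hA).map_root₂) ?_ hω ?_ ?_
    · push_cast; linarith
    · linarith
    · linarith
  · refine tendsto_of_tendsto_sin (a := 3 * forcingPeriod ω / 4) (b := forcingPeriod ω) (n := 2)
      (hev fun A hA => Ioo_subset_Icc_self (hcrit A hA).min_mem)
      (hextr tmin fun A hA =>
        (hcrit A hA).isLocalMin.hasDerivAt_eq_zero ((hY A hA.le).hasDerivAt _)) ?_ hω ?_ ?_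
    · push_cast; linarith
    · linarith
    · linarith
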